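/- For integers $h$ and $k>0$ put $$B_1(h,k)=\sum_{j=1}^{k-1}(-1)^{j+\left[\frac{hj}{k}\right]}\left[\frac{hj}{k}\right],$$ where $[x]$ denotes the greatest integer not exceeding $x$. **Theorem.** Let $h$ and $k$ be relatively prime integers with $k>0$. If $h+k$ is odd, then $$B_1(h,k)=\frac{2(1-h)}{\pi}\sum_{n=1}^{\infty}\frac{1}{2n-1}\tan\left(\frac{\pi h(2n-1)}{2k}\right),$$ where every tangent is defined (no argument is an odd multiple of $\pi/2$) and the series converges as the limit of its partial sums $\sum_{n=1}^{N}$ as $N\to\infty$. -/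

import Mathlib

open Filter Topology

/-- The sum `B₁(h,k) = ∑_{j=1}^{k-1} (-1)^(j + [hj/k]) [hj/k]` for integers `h` and `k > 0`,
where `[x]` is the greatest integer not exceeding the real number `x`. -/
noncomputable def sumB1 (h k : ℤ) : ℝ :=
  ∑ j ∈ Finset.Icc 1 (k - 1),
    (-1 : ℝ) ^ (j + ⌊(h * j : ℝ) / k⌋) * (⌊(h * j : ℝ) / k⌋ : ℝ)

/-- The `n`-th term (`n ≥ 1`) of the tangent series. -/
noncomputable def tanTerm (h k : ℤ) (n : ℕ) : ℝ :=
  1 / (2 * (n : ℝ) - 1) * Real.tan (Real.pi * h * (2 * (n : ℝ) - 1) / (2 * k))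

/-! The reflection `j ↦ k - j` reduces `sumB1` to `(h - 1) / 2` times the sum of the signs `(-1) ^
(j + ⌊hj/k⌋)` (`sumB1_eq`). Coprimality keeps `hj/k` off the integers, so `(-1) ^ ⌊hj/k⌋` is `4/π`
times the limit of the square-wave partial sums at `π h j / k`
(`tendsto_squareWavePartialSum_pi_mul`). Exchanging two finite sums, each harmonic contributes an
alternating sine sum over `j`, which equals minus a tangent (`sum_tanTerm_eq`); then `N → ∞`. The
square-wave limit comes from Leibniz's series at `π/2`, carried to other points by an `O(1/N)`
estimate. -/

/-- Partial sums of the Fourier series `∑ sin ((2i+1)x) / (2i+1)` of the square wave. -/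
noncomputable def squareWavePartialSum (N : ℕ) (x : ℝ) : ℝ :=
  ∑ i ∈ Finset.range N, Real.sin ((2 * (i : ℝ) + 1) * x) / (2 * (i : ℝ) + 1)

theorem sum_cos_odd_mul_sin (N : ℕ) (x : ℝ) :
    (∑ i ∈ Finset.range N, Real.cos ((2 * (i : ℝ) + 1) * x)) * (2 * Real.sin x) =
      Real.sin (2 * N * x) := by
  induction N with
  | zero => simp
  | succ n ih =>
    rw [Finset.sum_range_succ, add_mul, ih]
    have h1 : 2 * (n : ℝ) * x = (2 * (n : ℝ) + 1) * x - x := by ring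
    have h2 : 2 * ((n + 1 : ℕ) : ℝ) * x = (2 * (n : ℝ) + 1) * x + x := by push_cast; ring
    rw [h1, h2, Real.sin_add, Real.sin_sub]
    ring

theorem hasDerivAt_squareWavePartialSum (N : ℕ) (x : ℝ) :
    HasDerivAt (squareWavePartialSum N)
      (∑ i ∈ Finset.range N, Real.cos ((2 * (i : ℝ) + 1) * x)) x := by
  unfold squareWavePartialSum
  refine HasDerivAt.fun_sum fun i _ => ?_
  have h0 : (2 * (i : ℝ) + 1) ≠ 0 := by positivity
  have h := (((hasDerivAt_id x).const_mul (2 * (i : ℝ) + 1)).sin).div_const (2 * (i : ℝ) + 1)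
  refine h.congr_deriv ?_
  simp only [id, mul_one]
  field_simp

/-- Adding a boundary term turns the derivative of the partial sum into a quantity of order `1/N`. -/
theorem hasDerivAt_squareWavePartialSum_add (N : ℕ) (hN : 0 < N) (x : ℝ) (hx : Real.sin x ≠ 0) :
    HasDerivAt
      (fun t => squareWavePartialSum N t + Real.cos (2 * N * t) / (4 * N * Real.sin t))
      (-(Real.cos (2 * N * x) * Real.cos x) / (4 * N * Real.sin x ^ 2)) x := by
  have hN' : (N : ℝ) ≠ 0 := by positivity
  have h1 := hasDerivAt_squareWavePartialSum N x
  have h2 := (((hasDerivAt_id x).const_mul (2 * (N : ℝ))).cos).div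
    ((Real.hasDerivAt_sin x).const_mul (4 * (N : ℝ))) (by positivity)
  have h3 := h1.add h2
  refine h3.congr_deriv ?_
  have h4 : (∑ i ∈ Finset.range N, Real.cos ((2 * (i : ℝ) + 1) * x)) =
      Real.sin (2 * N * x) / (2 * Real.sin x) := by
    rw [← sum_cos_odd_mul_sin, mul_div_cancel_right₀ _ (by positivity)]
  rw [h4]
  simp only [id, mul_one]
  field_simp
  ring

theorem squareWavePartialSum_pi_div_two (N : ℕ) :
    squareWavePartialSum N (Real.pi / 2) =
      ∑ i ∈ Finset.range N, (-1 : ℝ) ^ i / (2 * (i : ℝ) + 1) := by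
  refine Finset.sum_congr rfl fun i _ => ?_
  have h : (2 * (i : ℝ) + 1) * (Real.pi / 2) = Real.pi / 2 + i * Real.pi := by ring
  rw [h, Real.sin_add_nat_mul_pi, Real.sin_pi_div_two, mul_one]

/-- Mean value inequality on `[x, π/2]` for the partial sum plus its boundary term; the boundary
values are themselves `O(1/N)`. -/
theorem abs_squareWavePartialSum_sub_le {N : ℕ} (hN : 0 < N) {x : ℝ} (hx : 0 < x)
    (hx' : x ≤ Real.pi / 2) :
    |squareWavePartialSum N (Real.pi / 2) - squareWavePartialSum N x| ≤
      (1 / Real.sin x ^ 2 * (Real.pi / 2 - x) + 1 + 1 / Real.sin x) / N := by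
  have hNpos : (0 : ℝ) < N := by exact_mod_cast hN
  have hs : 0 < Real.sin x := Real.sin_pos_of_pos_of_lt_pi hx (by linarith [Real.pi_pos])
  have hmono : ∀ t ∈ Set.Icc x (Real.pi / 2), Real.sin x ≤ Real.sin t := fun t ht =>
    Real.sin_le_sin_of_le_of_le_pi_div_two (by linarith [Real.pi_pos]) ht.2 ht.1
  have hmv := (convex_Icc x (Real.pi / 2)).norm_image_sub_le_of_norm_hasDerivWithin_le
    (f := fun t => squareWavePartialSum N t + Real.cos (2 * N * t) / (4 * N * Real.sin t))
    (f' := fun t => -(Real.cos (2 * N * t) * Real.cos t) / (4 * N * Real.sin t ^ 2))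
    -- Sine is smallest at `x` on this interval; the factor `1/4` is discarded.
    (C := 1 / (N * Real.sin x ^ 2))
    (fun t ht => (hasDerivAt_squareWavePartialSum_add N hN t
      (hs.trans_le (hmono t ht)).ne').hasDerivWithinAt)
    (fun t ht => by
      have hst := hmono t ht
      have hst0 := hs.trans_le hst
      rw [Real.norm_eq_abs, abs_div, abs_neg, abs_mul,
        abs_of_pos (show 0 < 4 * (N : ℝ) * Real.sin t ^ 2 by positivity)]
      refine div_le_div₀ zero_le_one
        (mul_le_one₀ (Real.abs_cos_le_one _) (abs_nonneg _) (Real.abs_cos_le_one _))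
        (by positivity) ?_
      have : Real.sin x ^ 2 ≤ Real.sin t ^ 2 := pow_le_pow_left₀ hs.le hst 2
      nlinarith [mul_le_mul_of_nonneg_left this hNpos.le, mul_pos hNpos (pow_pos hst0 2)])
    (Set.left_mem_Icc.2 hx') (Set.right_mem_Icc.2 hx')
  have hbd : ∀ y s : ℝ, 0 < s → |Real.cos y / (4 * N * s)| ≤ 1 / s / N := fun y s hs => by
    rw [abs_div, abs_of_pos (show 0 < 4 * (N : ℝ) * s by positivity), div_div]
    refine div_le_div₀ zero_le_one (Real.abs_cos_le_one _) (by positivity) ?_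
    nlinarith [mul_pos hs hNpos]
  have h1 := hbd (2 * N * x) (Real.sin x) hs
  have h2 := hbd (2 * N * (Real.pi / 2)) (Real.sin (Real.pi / 2)) (by simp)
  rw [Real.norm_eq_abs, Real.norm_eq_abs, abs_of_nonneg (sub_nonneg.2 hx')] at hmv
  have h3 : (1 / Real.sin x ^ 2 * (Real.pi / 2 - x) + 1 + 1 / Real.sin x) / N =
      1 / (N * Real.sin x ^ 2) * (Real.pi / 2 - x) + 1 / Real.sin (Real.pi / 2) / N +
        1 / Real.sin x / N := by
    rw [Real.sin_pi_div_two]; field_simp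
  rw [h3]
  simp only [abs_le] at *
  constructor <;> linarith [hmv.1, hmv.2, h1.1, h1.2, h2.1, h2.2]

theorem tendsto_squareWavePartialSum_of_le_pi_div_two {x : ℝ} (hx : 0 < x)
    (hx' : x ≤ Real.pi / 2) :
    Tendsto (fun N => squareWavePartialSum N x) atTop (𝓝 (Real.pi / 4)) := by
  have h1 : Tendsto (fun N => squareWavePartialSum N (Real.pi / 2)) atTop (𝓝 (Real.pi / 4)) := by
    simp only [squareWavePartialSum_pi_div_two]
    exact Real.tendsto_sum_pi_div_four
  have h2 : Tendsto
      (fun N => squareWavePartialSum N (Real.pi / 2) - squareWavePartialSum N x) atTop (𝓝 0) := by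
    refine squeeze_zero_norm' ?_ (tendsto_const_div_atTop_nhds_zero_nat
      (1 / Real.sin x ^ 2 * (Real.pi / 2 - x) + 1 + 1 / Real.sin x))
    filter_upwards [eventually_gt_atTop 0] with N hN
    exact abs_squareWavePartialSum_sub_le hN hx hx'
  simpa using h1.sub h2

theorem sin_odd_mul_pi_sub (i : ℕ) (x : ℝ) :
    Real.sin ((2 * (i : ℝ) + 1) * (Real.pi - x)) = Real.sin ((2 * (i : ℝ) + 1) * x) := by
  have h : (2 * (i : ℝ) + 1) * (Real.pi - x) =
      Real.pi - (2 * (i : ℝ) + 1) * x + i * (2 * Real.pi) := by ring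
  rw [h, Real.sin_add_nat_mul_two_pi, Real.sin_pi_sub]

theorem tendsto_squareWavePartialSum {x : ℝ} (hx : 0 < x) (hx' : x < Real.pi) :
    Tendsto (fun N => squareWavePartialSum N x) atTop (𝓝 (Real.pi / 4)) := by
  rcases le_total x (Real.pi / 2) with h | h
  · exact tendsto_squareWavePartialSum_of_le_pi_div_two hx h
  · have := tendsto_squareWavePartialSum_of_le_pi_div_two (x := Real.pi - x)
      (by linarith) (by linarith)
    simpa only [squareWavePartialSum, sin_odd_mul_pi_sub] using this

/-- The square wave of period `2` is the limit of its Fourier series off the integers. -/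
theorem tendsto_squareWavePartialSum_pi_mul {y : ℝ} (hy : Int.fract y ≠ 0) :
    Tendsto (fun N => squareWavePartialSum N (Real.pi * y)) atTop
      (𝓝 ((-1) ^ ⌊y⌋ * (Real.pi / 4))) := by
  have hpos : 0 < Int.fract y := lt_of_le_of_ne (Int.fract_nonneg y) hy.symm
  have h := (tendsto_squareWavePartialSum (x := Real.pi * Int.fract y)
    (mul_pos Real.pi_pos hpos)
    (by nlinarith [Int.fract_lt_one y, Real.pi_pos])).const_mul ((-1 : ℝ) ^ ⌊y⌋)
  refine h.congr fun N => ?_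
  rw [squareWavePartialSum, squareWavePartialSum, Finset.mul_sum]
  refine Finset.sum_congr rfl fun i _ => ?_
  have hy' : (2 * (i : ℝ) + 1) * (Real.pi * y) =
      (2 * (i : ℝ) + 1) * (Real.pi * Int.fract y) + (((2 * i + 1) * ⌊y⌋ : ℤ) : ℝ) * Real.pi := by
    conv_lhs => rw [← Int.fract_add_floor y]
    push_cast; ring
  -- Only odd harmonics occur, so a shift by `⌊y⌋ π` gives all of them the same sign.
  have hsign : (-1 : ℝ) ^ ((2 * (i : ℤ) + 1) * ⌊y⌋) = (-1) ^ ⌊y⌋ := by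
    rw [zpow_mul, Odd.neg_one_zpow ⟨(i : ℤ), rfl⟩]
  rw [hy', Real.sin_add_int_mul_pi, hsign, mul_div_assoc]

/-- Telescopes, since `2 sin(2jθ) cos θ = sin((2j+1)θ) + sin((2j-1)θ)`. -/
theorem sum_Icc_neg_one_zpow_mul_sin_mul_cos (θ : ℝ) (m : ℕ) :
    (∑ j ∈ Finset.Icc (1 : ℤ) m, (-1 : ℝ) ^ j * Real.sin (2 * j * θ)) * Real.cos θ =
      ((-1) ^ m * Real.sin ((2 * m + 1) * θ) - Real.sin θ) / 2 := by
  induction m with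
  | zero => simp
  | succ m ih =>
    have hI : Finset.Icc (1 : ℤ) ((m + 1 : ℕ) : ℤ) =
        insert ((m : ℤ) + 1) (Finset.Icc (1 : ℤ) m) := by
      ext j; simp only [Finset.mem_Icc, Finset.mem_insert]; omega
    rw [hI, Finset.sum_insert (by simp), add_mul, ih]
    have hz : (-1 : ℝ) ^ ((m : ℤ) + 1) = -(-1) ^ m := by
      rw [zpow_add_one₀ (by norm_num), zpow_natCast]; ring
    have h1 : (2 * (m : ℝ) + 1) * θ = 2 * ((m : ℝ) + 1) * θ - θ := by ring
    have h2 : (2 * ((m + 1 : ℕ) : ℝ) + 1) * θ = 2 * ((m : ℝ) + 1) * θ + θ := by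
      push_cast; ring
    rw [hz, h1, h2, Real.sin_add, Real.sin_sub, pow_succ]
    push_cast
    ring

theorem sum_Icc_neg_one_zpow_mul_sin {θ : ℝ} {k a : ℤ} (hk : 0 < k) (hθ : 2 * k * θ = a * Real.pi)
    (hodd : Odd (a + k)) (hcos : Real.cos θ ≠ 0) :
    ∑ j ∈ Finset.Icc 1 (k - 1), (-1 : ℝ) ^ j * Real.sin (2 * j * θ) = -Real.tan θ := by
  obtain ⟨m, hm⟩ := Int.eq_ofNat_of_zero_le (show 0 ≤ k - 1 by omega)
  have hkm : k = m + 1 := by omega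
  have h := sum_Icc_neg_one_zpow_mul_sin_mul_cos θ m
  have hang : (2 * (m : ℝ) + 1) * θ = a * Real.pi - θ := by
    rw [← hθ, hkm]; push_cast; ring
  have hsign : (-1 : ℝ) ^ m * (-1) ^ a = 1 := by
    rw [← zpow_natCast, ← zpow_add₀ (by norm_num)]
    apply Even.neg_one_zpow
    rw [hkm] at hodd
    obtain ⟨c, hc⟩ := hodd
    exact ⟨c, by omega⟩
  have hsin : Real.sin (a * Real.pi - θ) = -((-1) ^ a * Real.sin θ) := Real.sin_int_mul_pi_sub θ a
  rw [hang, hsin] at h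
  rw [hm, Real.tan_eq_sin_div_cos, ← neg_div, eq_div_iff hcos, h]
  linear_combination (-Real.sin θ / 2) * hsign

/-- A zero would make an odd multiple of `h` equal an odd multiple of `k`, forcing equal parity. -/
theorem cos_pi_mul_odd_div_ne_zero {h k : ℤ} (hk : 0 < k) (hodd : Odd (h + k)) (n : ℕ) :
    Real.cos (Real.pi * h * (2 * (n : ℝ) - 1) / (2 * k)) ≠ 0 := by
  have hk' : (k : ℝ) ≠ 0 := by exact_mod_cast hk.ne'
  rw [Real.cos_ne_zero_iff]
  intro m hm
  have hreal : (h : ℝ) * (2 * n - 1) = (2 * m + 1) * k := by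
    field_simp at hm
    linear_combination hm
  have hint : h * (2 * n - 1) = (2 * m + 1) * k := by exact_mod_cast hreal
  have hpar := congrArg Even hint
  have h1 : ¬ Even (2 * (n : ℤ) - 1) := by simp [parity_simps]
  have h2 : ¬ Even (2 * m + 1) := by simp [parity_simps]
  rw [Int.even_mul, Int.even_mul] at hpar
  rw [← Int.not_even_iff_odd, Int.even_add] at hodd
  simp only [h1, h2, or_false, false_or, eq_iff_iff] at hpar
  exact hodd hpar

theorem fract_mul_div_ne_zero {h k j : ℤ} (hcop : IsCoprime h k)
    (hj : j ∈ Finset.Icc 1 (k - 1)) : Int.fract ((h * j : ℝ) / k) ≠ 0 := by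
  rw [Finset.mem_Icc] at hj
  have hk : (k : ℝ) ≠ 0 := by exact_mod_cast (show k ≠ 0 by omega)
  rw [Int.fract_ne_zero_iff]
  rintro ⟨z, hz⟩
  rw [eq_div_iff hk] at hz
  have hz' : z * k = h * j := by exact_mod_cast hz
  have hdvd : k ∣ j := hcop.symm.dvd_of_dvd_mul_left ⟨z, by linarith⟩
  have := Int.le_of_dvd (by omega) hdvd
  omega

theorem floor_mul_sub_div {h k j : ℤ} (hcop : IsCoprime h k) (hj : j ∈ Finset.Icc 1 (k - 1)) :
    ⌊(h * (k - j : ℤ) : ℝ) / k⌋ = h - 1 - ⌊(h * j : ℝ) / k⌋ := by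
  have hf := fract_mul_div_ne_zero hcop hj
  have hpos : 0 < Int.fract ((h * j : ℝ) / k) := lt_of_le_of_ne (Int.fract_nonneg _) hf.symm
  have hlt := Int.fract_lt_one ((h * j : ℝ) / k)
  rw [Finset.mem_Icc] at hj
  have hk : (k : ℝ) ≠ 0 := by exact_mod_cast (show k ≠ 0 by omega)
  have he : (h * (k - j : ℤ) : ℝ) / k = h - (h * j : ℝ) / k := by
    push_cast; field_simp
  have hd := Int.self_sub_floor ((h * j : ℝ) / k)
  rw [he, Int.floor_eq_iff]
  push_cast
  constructor <;> linarith

/-- The reflection `j ↦ k - j` removes the weight `[hj/k]` from `B₁(h,k)`. -/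
theorem sumB1_eq {h k : ℤ} (hcop : IsCoprime h k) (hodd : Odd (h + k)) :
    sumB1 h k = (h - 1) / 2 *
      ∑ j ∈ Finset.Icc 1 (k - 1), (-1 : ℝ) ^ (j + ⌊(h * j : ℝ) / k⌋) := by
  have hrefl : sumB1 h k = ∑ j ∈ Finset.Icc 1 (k - 1),
      (-1 : ℝ) ^ (j + ⌊(h * j : ℝ) / k⌋) * ((h : ℝ) - 1 - (⌊(h * j : ℝ) / k⌋ : ℝ)) := by
    unfold sumB1
    refine Finset.sum_nbij' (fun j => k - j) (fun j => k - j) ?_ ?_ ?_ ?_ ?_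
    · intro j hj; rw [Finset.mem_Icc] at *; omega
    · intro j hj; rw [Finset.mem_Icc] at *; omega
    · intro j _; ring
    · intro j _; ring
    · intro j hj
      rw [floor_mul_sub_div hcop hj]
      obtain ⟨c, hc⟩ := hodd
      -- As `h + k - 1` is even, the reflection preserves the sign.
      have hexp : k - j + (h - 1 - ⌊(h * j : ℝ) / k⌋) =
          (j + ⌊(h * j : ℝ) / k⌋) + 2 * (c - j - ⌊(h * j : ℝ) / k⌋) := by
        linear_combination hc
      rw [hexp, zpow_add₀ (by norm_num : (-1 : ℝ) ≠ 0) (j + _),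
        Even.neg_one_zpow (even_two_mul _), mul_one]
      push_cast; ring
  have hsum : sumB1 h k + sumB1 h k = (h - 1) *
      ∑ j ∈ Finset.Icc 1 (k - 1), (-1 : ℝ) ^ (j + ⌊(h * j : ℝ) / k⌋) := by
    nth_rewrite 2 [hrefl]
    rw [sumB1, ← Finset.sum_add_distrib, Finset.mul_sum]
    exact Finset.sum_congr rfl fun j _ => by ring
  linarith

theorem sum_tanTerm_eq {h k : ℤ} (hk : 0 < k) (hodd : Odd (h + k)) (N : ℕ) :
    ∑ n ∈ Finset.Icc 1 N, tanTerm h k n =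
      -∑ j ∈ Finset.Icc 1 (k - 1),
        (-1 : ℝ) ^ j * squareWavePartialSum N (Real.pi * ((h * j : ℝ) / k)) := by
  have hk' : (k : ℝ) ≠ 0 := by exact_mod_cast hk.ne'
  have hswap : ∑ j ∈ Finset.Icc 1 (k - 1),
        (-1 : ℝ) ^ j * squareWavePartialSum N (Real.pi * ((h * j : ℝ) / k)) =
      ∑ i ∈ Finset.range N, ∑ j ∈ Finset.Icc 1 (k - 1), (-1 : ℝ) ^ j *
        (Real.sin ((2 * (i : ℝ) + 1) * (Real.pi * ((h * j : ℝ) / k))) / (2 * (i : ℝ) + 1)) := by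
    simp only [squareWavePartialSum, Finset.mul_sum]
    exact Finset.sum_comm
  have hshift : ∑ n ∈ Finset.Icc 1 N, tanTerm h k n =
      ∑ i ∈ Finset.range N, tanTerm h k (i + 1) := by
    rw [Finset.range_eq_Ico, Finset.sum_Ico_add' (tanTerm h k) 0 N 1]
    rfl
  rw [hswap, hshift, ← Finset.sum_neg_distrib]
  refine Finset.sum_congr rfl fun i _ => ?_
  -- `h (2i+1)` has the parity of `h`, so one sine-sum formula serves every harmonic.
  have hpar : Odd (h * (2 * (i : ℤ) + 1) + k) := by
    obtain ⟨c, hc⟩ := hodd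
    exact ⟨c + h * i, by linear_combination hc⟩
  have hs := sum_Icc_neg_one_zpow_mul_sin
    (θ := Real.pi * h * (2 * ((i + 1 : ℕ) : ℝ) - 1) / (2 * k)) (a := h * (2 * (i : ℤ) + 1)) hk
    (by push_cast; field_simp; ring) hpar (cos_pi_mul_odd_div_ne_zero hk hodd (i + 1))
  have hr : ∑ j ∈ Finset.Icc 1 (k - 1), (-1 : ℝ) ^ j *
        (Real.sin ((2 * (i : ℝ) + 1) * (Real.pi * ((h * j : ℝ) / k))) / (2 * (i : ℝ) + 1)) =
      (∑ j ∈ Finset.Icc 1 (k - 1), (-1 : ℝ) ^ j * Real.sin (2 * j *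
        (Real.pi * h * (2 * ((i + 1 : ℕ) : ℝ) - 1) / (2 * k)))) / (2 * (i : ℝ) + 1) := by
    rw [Finset.sum_div]
    refine Finset.sum_congr rfl fun j _ => ?_
    have hang : (2 * (i : ℝ) + 1) * (Real.pi * ((h * j : ℝ) / k)) =
        2 * j * (Real.pi * h * (2 * ((i + 1 : ℕ) : ℝ) - 1) / (2 * k)) := by
      push_cast; field_simp; ring
    rw [hang]
    ring
  rw [hr, hs, tanTerm]
  push_cast
  ring

theorem mainTheorem9 (h k : ℤ) (hk : 0 < k) (hcop : IsCoprime h k) (hodd : Odd (h + k)) :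
    (∀ n : ℕ, 1 ≤ n → Real.cos (Real.pi * h * (2 * (n : ℝ) - 1) / (2 * k)) ≠ 0) ∧
    ∃ T : ℝ,
      Tendsto (fun N : ℕ => ∑ n ∈ Finset.Icc 1 N, tanTerm h k n) atTop (𝓝 T) ∧
      sumB1 h k = 2 * (1 - (h : ℝ)) / Real.pi * T := by
  refine ⟨fun n _ => cos_pi_mul_odd_div_ne_zero hk hodd n,
    -∑ j ∈ Finset.Icc 1 (k - 1), (-1 : ℝ) ^ j * ((-1) ^ ⌊(h * j : ℝ) / k⌋ * (Real.pi / 4)),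
    ?_, ?_⟩
  · simp only [sum_tanTerm_eq hk hodd]
    exact (tendsto_finsetSum _ fun j hj =>
      (tendsto_squareWavePartialSum_pi_mul (fract_mul_div_ne_zero hcop hj)).const_mul _).neg
  · have hsum : ∑ j ∈ Finset.Icc 1 (k - 1),
          (-1 : ℝ) ^ j * ((-1) ^ ⌊(h * j : ℝ) / k⌋ * (Real.pi / 4)) =
        (∑ j ∈ Finset.Icc 1 (k - 1), (-1 : ℝ) ^ (j + ⌊(h * j : ℝ) / k⌋)) * (Real.pi / 4) := by
      rw [Finset.sum_mul]
      refine Finset.sum_congr rfl fun j _ => ?_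
      rw [zpow_add₀ (by norm_num), mul_assoc]
    rw [hsum, sumB1_eq hcop hodd]
    have := Real.pi_ne_zero
    field_simp
    ring
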